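/- Let $H_1$ be the graph with vertices $A,B,C,D,E,F$ and edges $AB,BC,CD,EF$ (the path $A$–$B$–$C$–$D$ together with a disjoint edge $EF$). The Game of Graph Nim on a graph whose edges carry non-negative integer weights is played by two players who move alternately: a move consists of selecting a vertex $u$ and removing a non-negative integer weight from each edge incident on $u$, so that the total weight removed is strictly positive and all remaining weights are non-negative. The game ends when all edge-weights are $0$, and the player who made the last move wins. A weight configuration is called losing if the player who moves first loses under optimal play. For a positive integer $k$ let $f(k)$ be the unique non-negative integer with $2^{f(k)}\le k<2^{f(k)+1}$. Theorem. Let $k\ge 1$ and $m\ge 0$ be integers, and let $w$ be an assignment of strictly positive integer weights to the edges of $H_1$ with $w(EF)=k$. Then each of the following is true (equalities of pairs being equalities of multisets). 1. If $\{w(AB),w(CD)\}=\{2^{f(k)+1}m+r,\;2^{f(k)+1}m+k-r-s\}$ and $w(BC)=s$ for some $r\in\{0,1,3\}$ and $s\in\{1,2,\dots,k-2r\}$, then $w$ is losing. 2. If $\{w(AB),w(CD)\}=\{2^{f(k)+1}m+r,\;2^{f(k)+1}m+k+r-s\}$ and $w(BC)=s$ for some $r\in\{2,4\}$ and $s\in\{1,\dots,r-1\}$,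 and $k\equiv j \pmod{2^{f(r)+1}}$ for some $j\in\{s,s+1,\dots,r-1\}$, then $w$ is losing. 3. If $\{w(AB),w(CD)\}=\{2^{f(k)+1}m+r,\;2^{f(k)+1}m+k-r-s\}$ and $w(BC)=s$ for some $r\in\{2,4\}$ and $s\in\{1,\dots,r-1\}$, and $k\ge 3r$, and $k\equiv j \pmod{2^{f(r)+1}}$ for some $j\in\{0,1,\dots,2^{f(r)+1}-1\}\setminus\{s,s+1,\dots,r-1\}$, then $w$ is losing. 4. If $\{w(AB),w(CD)\}=\{2^{f(k)+1}m+r,\;2^{f(k)+1}m+k-r-s\}$ and $w(BC)=s$ for some $r\in\{2,4\}$ and $s\in\{r,r+1,\dots,k-2r\}$, and $k\ge 3r$, then $w$ is losing. -/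

import Mathlib

namespace GraphNim

/-- A weight configuration on `G`: a non-negative integer weight on every edge of `G`. -/
abbrev Config {V : Type*} (G : SimpleGraph V) : Type _ := G.edgeSet → ℕ

/-- `Move w w'`: one round of Graph Nim leads from `w` to `w'`. The player selects a vertex `u` and
removes a non-negative integer weight from each edge incident on `u`, the total weight removed
being strictly positive; all other edges keep their weights. -/
def Move {V : Type*} {G : SimpleGraph V} (w w' : Config G) : Prop :=
  ∃ u : V, (∀ e, w' e ≤ w e) ∧ (∀ e : G.edgeSet, u ∉ e.val → w' e = w e) ∧ ∃ e, w' e < w e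

/-- `IsLosing w`: starting from `w`, the player who plays the first round is destined to lose, i.e.
for every move `w → w'` of that player the opponent has a reply `w' → reply w'` to a configuration
that is again losing for the player who is now about to move. In particular the configuration
without any weight left, in which the opponent has just played the last round, is losing. -/
inductive IsLosing {V : Type*} {G : SimpleGraph V} : Config G → Prop
  | intro {w : Config G} (reply : ∀ w', Move w w' → Config G)
      (reply_move : ∀ w' (h : Move w w'), Move w' (reply w' h))
      (reply_losing : ∀ w' (h : Move w w'), IsLosing (reply w' h)) : IsLosing w

/-- The six vertices of the graph `H1`. -/
inductive Vertex : Type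
  | A | B | C | D | E | F

/-- The graph `H1`: the path `A - B - C - D` together with the disjoint edge `EF`. -/
def H1 : SimpleGraph Vertex :=
  SimpleGraph.fromEdgeSet
    {s(Vertex.A, Vertex.B), s(Vertex.B, Vertex.C), s(Vertex.C, Vertex.D), s(Vertex.E, Vertex.F)}

/-- The edge `AB` of `H1`. -/
def edgeAB : H1.edgeSet := ⟨s(Vertex.A, Vertex.B), by simp [H1]⟩

/-- The edge `BC` of `H1`. -/
def edgeBC : H1.edgeSet := ⟨s(Vertex.B, Vertex.C), by simp [H1]⟩

/-- The edge `CD` of `H1`. -/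
def edgeCD : H1.edgeSet := ⟨s(Vertex.C, Vertex.D), by simp [H1]⟩

/-- The edge `EF` of `H1`. -/
def edgeEF : H1.edgeSet := ⟨s(Vertex.E, Vertex.F), by simp [H1]⟩

/-- For `k ≥ 1`, the integer `f k` with `2 ^ f k ≤ k < 2 ^ (f k + 1)`. -/
def f (k : ℕ) : ℕ := Nat.log 2 k

/-- The defining property of `f`, with uniqueness. -/
theorem f_eq_iff {k n : ℕ} (hk : 0 < k) : f k = n ↔ 2 ^ n ≤ k ∧ k < 2 ^ (n + 1) :=
  Nat.log_eq_iff (Or.inr ⟨Nat.one_lt_two, hk.ne'⟩)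

end GraphNim

/-!
By the Sprague-Grundy theory, a configuration on `H1` is losing exactly if the weight of the isolated
edge `EF` is the Grundy value of the path `A - B - C - D` with its weights `a`, `b`, `c`. Two facts
carry the proof.

* If `a` or `c` is at most `4`, the Grundy value of the path has a closed form (`grundy`). For `b = 0`
  it is the nim sum of `a` and `c`. For `b > 0` it is `a + b + c`, except for small `b` and a few
  residues of the larger outer weight modulo `4` (if the smaller one is `2`) or modulo `8` (if that
  is `4`), where it is `b + |c - a|`. That this is the Grundy function is the content of `grundy_ne` (no move
  preserves the value) and `exists_grundy_eq` (every smaller value is reached by some move). The value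
  `a + b + c` is the largest conceivable one, so `grundy_ne` is immediate away from the exceptions.
* Adding the same multiple `M` of `2 ^ q` to `a` and `c`, where `a`, `c` and the value are less than
  `2 ^ q`, preserves the losing property (`exists_reply`). Moves that keep both outer weights at least
  `M` are answered as without the shift. If an outer weight drops to `x < M`, the opponent empties `BC`
  and makes the other outer weight equal to the nim sum of `x` and the weight of `EF`, which is less
  than `M` (`xor_lt_of_dvd`); the result is a balanced position of three-heap Nim.

Hence the `Shifted` positions are closed under answering moves, and each of them is losing by induction
on the total weight (`isLosing_of_closed`). The configurations in question are `Shifted`, with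
`q = f k + 1` and `M = 2 ^ q * m`: those with the weight `k - r - s` have the value `a + b + c`
(`shifted_of_add`), those with `k + r - s` are exceptional, or, if `k < r`, become
positions with a zero outer weight once `r` is added to `M` (`shifted_of_exceptional`).
-/

namespace GraphNim

/-! ### The game in coordinates -/

/-- A move on the path `A - B - C - D` whose edges have the weights `a`, `b`, `c`: the player reduces
`a` and `b` (vertex `A` or `B`) or `b` and `c` (vertex `C` or `D`). -/
def PathMove (a b c a' b' c' : ℕ) : Prop :=
  (c' = c ∧ a' ≤ a ∧ b' ≤ b ∧ a' + b' < a + b) ∨ (a' = a ∧ b' ≤ b ∧ c' ≤ c ∧ b' + c' < b + c)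

theorem PathMove.symm {a b c a' b' c' : ℕ} (h : PathMove a b c a' b' c') :
    PathMove c b a c' b' a' := by
  unfold PathMove at *; omega

/-- A move on `H1` in terms of the weights of `AB`, `BC`, `CD`, `EF`. -/
def QuadMove (a b c k a' b' c' k' : ℕ) : Prop :=
  (k' = k ∧ PathMove a b c a' b' c') ∨ (a' = a ∧ b' = b ∧ c' = c ∧ k' < k)

theorem edge_cases (e : H1.edgeSet) : e = edgeAB ∨ e = edgeBC ∨ e = edgeCD ∨ e = edgeEF := by
  obtain ⟨e, he⟩ := e
  simp only [H1, SimpleGraph.edgeSet_fromEdgeSet, Set.mem_sdiff, Set.mem_insert_iff,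
    Set.mem_singleton_iff] at he
  simpa [edgeAB, edgeBC, edgeCD, edgeEF] using he.1

open Classical in
/-- The configuration on `H1` with the given weights of `AB`, `BC`, `CD`, `EF`. -/
noncomputable def ofWeights (a b c k : ℕ) : Config H1 := fun e =>
  if e = edgeAB then a else if e = edgeBC then b else if e = edgeCD then c else k

theorem ofWeights_edgeAB (a b c k : ℕ) : ofWeights a b c k edgeAB = a := by simp [ofWeights]

theorem ofWeights_edgeBC (a b c k : ℕ) : ofWeights a b c k edgeBC = b := by
  simp [ofWeights, edgeAB, edgeBC]

theorem ofWeights_edgeCD (a b c k : ℕ) : ofWeights a b c k edgeCD = c := by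
  simp [ofWeights, edgeAB, edgeBC, edgeCD]

theorem ofWeights_edgeEF (a b c k : ℕ) : ofWeights a b c k edgeEF = k := by
  simp [ofWeights, edgeAB, edgeBC, edgeCD, edgeEF]

theorem forall_edge {p : H1.edgeSet → Prop} :
    (∀ e, p e) ↔ p edgeAB ∧ p edgeBC ∧ p edgeCD ∧ p edgeEF := by
  refine ⟨fun h => ⟨h _, h _, h _, h _⟩, fun ⟨h₁, h₂, h₃, h₄⟩ e => ?_⟩
  rcases edge_cases e with rfl | rfl | rfl | rfl <;> assumption

theorem exists_edge {p : H1.edgeSet → Prop} :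
    (∃ e, p e) ↔ p edgeAB ∨ p edgeBC ∨ p edgeCD ∨ p edgeEF := by
  refine ⟨fun ⟨e, h⟩ => ?_, fun h => ?_⟩
  · rcases edge_cases e with rfl | rfl | rfl | rfl <;> tauto
  · rcases h with h | h | h | h <;> exact ⟨_, h⟩

theorem move_iff (w w' : Config H1) :
    Move w w' ↔ QuadMove (w edgeAB) (w edgeBC) (w edgeCD) (w edgeEF)
      (w' edgeAB) (w' edgeBC) (w' edgeCD) (w' edgeEF) := by
  unfold Move QuadMove PathMove
  simp only [forall_edge, exists_edge]
  constructor
  · rintro ⟨u, h⟩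
    cases u <;> simp [edgeAB, edgeBC, edgeCD, edgeEF] at h ⊢ <;> omega
  · rintro (⟨hk, h | h⟩ | h)
    · refine ⟨Vertex.B, ?_⟩
      simp [edgeAB, edgeBC, edgeCD, edgeEF] at h hk ⊢; omega
    · refine ⟨Vertex.C, ?_⟩
      simp [edgeAB, edgeBC, edgeCD, edgeEF] at h hk ⊢; omega
    · refine ⟨Vertex.E, ?_⟩
      simp [edgeAB, edgeBC, edgeCD, edgeEF] at h ⊢; omega

/-- A family of positions in which every move can be answered by a move back into the family
consists of losing positions. -/
theorem isLosing_of_closed (P : ℕ → ℕ → ℕ → ℕ → Prop)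
    (hP : ∀ a b c k, P a b c k → ∀ a' b' c' k', QuadMove a b c k a' b' c' k' →
      ∃ x y z t, QuadMove a' b' c' k' x y z t ∧ P x y z t)
    (w : Config H1) (hw : P (w edgeAB) (w edgeBC) (w edgeCD) (w edgeEF)) : IsLosing w := by
  induction hn : w edgeAB + w edgeBC + w edgeCD + w edgeEF using Nat.strong_induction_on
    generalizing w with
  | _ n ih =>
    have key : ∀ w', Move w w' → ∃ v, Move w' v ∧ IsLosing v := by
      intro w' h
      have h' := (move_iff w w').1 h
      obtain ⟨x, y, z, t, hm, hv⟩ := hP _ _ _ _ hw _ _ _ _ h'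
      refine ⟨ofWeights x y z t, ?_, ?_⟩
      · rw [move_iff]
        simpa only [ofWeights_edgeAB, ofWeights_edgeBC, ofWeights_edgeCD, ofWeights_edgeEF] using hm
      · refine ih (x + y + z + t) ?_ _ ?_ ?_
        · unfold QuadMove PathMove at h' hm; omega
        · simpa only [ofWeights_edgeAB, ofWeights_edgeBC, ofWeights_edgeCD, ofWeights_edgeEF]
            using hv
        · simp only [ofWeights_edgeAB, ofWeights_edgeBC, ofWeights_edgeCD, ofWeights_edgeEF]
    choose reply h₁ h₂ using key
    exact ⟨reply, h₁, h₂⟩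

/-! ### Nim sums with a small summand -/

theorem xor_eq_of_lt_eight {a : ℕ} (ha : a < 8) (c : ℕ) :
    a ^^^ c = 8 * (c / 8) + (a ^^^ (c % 8)) := by
  have h₁ : (a ^^^ c) / 2 ^ 3 = a / 2 ^ 3 ^^^ c / 2 ^ 3 := Nat.xor_div_two_pow
  have h₂ : (a ^^^ c) % 2 ^ 3 = a % 2 ^ 3 ^^^ c % 2 ^ 3 := Nat.xor_mod_two_pow
  norm_num [Nat.mod_eq_of_lt ha, Nat.div_eq_of_lt ha] at h₁ h₂
  omega

theorem one_xor_cases (c : ℕ) : (1 ^^^ c) + 2 * (c % 2) = c + 1 := by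
  have h := xor_eq_of_lt_eight (show 1 < 8 by norm_num) c
  have hy := (by decide : ∀ y < 8, (1 ^^^ y) + 2 * (y % 2) = y + 1) (c % 8)
    (Nat.mod_lt _ (by norm_num))
  rw [h]
  generalize 1 ^^^ (c % 8) = y at *
  omega

theorem two_xor_cases (c : ℕ) :
    (c % 4 < 2 ∧ 2 ^^^ c = c + 2) ∨ (2 ≤ c % 4 ∧ (2 ^^^ c) + 2 = c) := by
  have h := xor_eq_of_lt_eight (show 2 < 8 by norm_num) c
  have hy := (by decide : ∀ y < 8, (y % 4 < 2 ∧ 2 ^^^ y = y + 2) ∨ (2 ≤ y % 4 ∧ (2 ^^^ y) + 2 = y))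
    (c % 8) (Nat.mod_lt _ (by norm_num))
  rw [h]
  generalize 2 ^^^ (c % 8) = y at *
  omega

theorem three_xor_cases (c : ℕ) : (3 ^^^ c) + 2 * (c % 4) = c + 3 := by
  have h := xor_eq_of_lt_eight (show 3 < 8 by norm_num) c
  have hy := (by decide : ∀ y < 8, (3 ^^^ y) + 2 * (y % 4) = y + 3) (c % 8)
    (Nat.mod_lt _ (by norm_num))
  rw [h]
  generalize 3 ^^^ (c % 8) = y at *
  omega

theorem four_xor_cases (c : ℕ) :
    (c % 8 < 4 ∧ 4 ^^^ c = c + 4) ∨ (4 ≤ c % 8 ∧ (4 ^^^ c) + 4 = c) := by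
  have h := xor_eq_of_lt_eight (show 4 < 8 by norm_num) c
  have hy := (by decide : ∀ y < 8, (y < 4 ∧ 4 ^^^ y = y + 4) ∨ (4 ≤ y ∧ (4 ^^^ y) + 4 = y))
    (c % 8) (Nat.mod_lt _ (by norm_num))
  rw [h]
  generalize 4 ^^^ (c % 8) = y at *
  omega

/-- The nim sums with a summand at most `4`, in a form suited to linear arithmetic. -/
theorem xor_of_le_four {a : ℕ} (ha : a ≤ 4) (c : ℕ) :
    (a = 0 ∧ a ^^^ c = c) ∨ (a = 1 ∧ (a ^^^ c) + 2 * (c % 2) = c + 1) ∨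
    (a = 2 ∧ c % 4 < 2 ∧ a ^^^ c = c + 2) ∨ (a = 2 ∧ 2 ≤ c % 4 ∧ (a ^^^ c) + 2 = c) ∨
    (a = 3 ∧ (a ^^^ c) + 2 * (c % 4) = c + 3) ∨
    (a = 4 ∧ c % 8 < 4 ∧ a ^^^ c = c + 4) ∨ (a = 4 ∧ 4 ≤ c % 8 ∧ (a ^^^ c) + 4 = c) := by
  obtain rfl | rfl | rfl | rfl | rfl : a = 0 ∨ a = 1 ∨ a = 2 ∨ a = 3 ∨ a = 4 := by omega
  · exact Or.inl ⟨rfl, Nat.zero_xor c⟩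
  · exact Or.inr (Or.inl ⟨rfl, one_xor_cases c⟩)
  · rcases two_xor_cases c with h | h
    · exact Or.inr (Or.inr (Or.inl ⟨rfl, h⟩))
    · exact Or.inr (Or.inr (Or.inr (Or.inl ⟨rfl, h⟩)))
  · exact Or.inr (Or.inr (Or.inr (Or.inr (Or.inl ⟨rfl, three_xor_cases c⟩))))
  · rcases four_xor_cases c with h | h
    · exact Or.inr (Or.inr (Or.inr (Or.inr (Or.inr (Or.inl ⟨rfl, h⟩)))))
    · exact Or.inr (Or.inr (Or.inr (Or.inr (Or.inr (Or.inr ⟨rfl, h⟩)))))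

theorem xor_le_add (a c : ℕ) : a ^^^ c ≤ a + c := by
  induction a using Nat.strong_induction_on generalizing c with
  | _ a ih =>
    rcases Nat.eq_zero_or_pos a with rfl | ha
    · simp
    · have h₁ := ih (a / 2) (by omega) (c / 2)
      have h₂ : (a ^^^ c) / 2 = a / 2 ^^^ c / 2 := Nat.xor_div_two
      have h₃ : (a ^^^ c) % 2 = (a + c) % 2 := Nat.xor_mod_two_eq
      omega

/-! ### The Grundy function of the path with a short outer edge -/

/-- The weights `a`, `b`, `c` with `a ≤ 4`, `a ≤ c` and `b > 0` for which the Grundy value of the path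
`A - B - C - D` is `b + (c - a)` and not `a + b + c`: those for which `a` is a power of `2` that occurs
in the binary expansion of `c`, and `b + c` has the same digits as `c` from that of `a` upwards. -/
def Exceptional (a b c : ℕ) : Prop :=
  (a = 2 ∧ b = 1 ∧ c % 4 = 2) ∨ (a = 4 ∧ 4 ≤ c % 8 ∧ b + c % 8 ≤ 7)

open Classical in
/-- A symmetric formula for the Grundy value of the path `A - B - C - D` with weights `a`, `b`, `c`,
provided that `b = 0` or one of `a`, `c` is at most `4`. One of the two truncated differences
vanishes. -/
noncomputable def grundy (a b c : ℕ) : ℕ :=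
  if b = 0 then a ^^^ c
  else if Exceptional a b c ∨ Exceptional c b a then b + ((a - c) + (c - a))
  else a + b + c

theorem grundy_symm (a b c : ℕ) : grundy a b c = grundy c b a := by
  unfold grundy
  split_ifs with h₁ h₂ h₃ h₃
  · exact Nat.xor_comm a c
  · omega
  · exact absurd h₂.symm h₃
  · exact absurd h₃.symm h₂
  · omega

theorem grundy_zero (a c : ℕ) : grundy a 0 c = a ^^^ c := if_pos rfl

theorem grundy_cases {a b c : ℕ} (hb : 0 < b) :
    ((Exceptional a b c ∨ Exceptional c b a) ∧ grundy a b c = b + ((a - c) + (c - a))) ∨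
    (¬ (Exceptional a b c ∨ Exceptional c b a) ∧ grundy a b c = a + b + c) := by
  unfold grundy
  split_ifs with h₁ h₂
  · omega
  · exact Or.inl ⟨h₂, rfl⟩
  · exact Or.inr ⟨h₂, rfl⟩

theorem grundy_eq_of_exceptional {a b c : ℕ} (hb : 0 < b) (h : Exceptional a b c) :
    grundy a b c = b + ((a - c) + (c - a)) := by
  rcases grundy_cases (a := a) (c := c) hb with h' | h'
  · exact h'.2
  · exact absurd (Or.inl h) h'.1

theorem grundy_eq_add {a b c : ℕ} (h₁ : ¬ Exceptional a b c) (h₂ : ¬ Exceptional c b a)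
    (hb : 0 < b) : grundy a b c = a + b + c := by
  rcases grundy_cases (a := a) (c := c) hb with h' | h'
  · exact absurd h'.1 (by tauto)
  · exact h'.2

/-- The positions for which `grundy` is the Grundy function. -/
def Tame (a b c : ℕ) : Prop := b = 0 ∨ a ≤ 4 ∨ c ≤ 4

theorem Tame.symm {a b c : ℕ} (h : Tame a b c) : Tame c b a := by
  unfold Tame at *; omega

theorem Tame.pathMove {a b c a' b' c' : ℕ} (h : Tame a b c) (hm : PathMove a b c a' b' c') :
    Tame a' b' c' := by
  unfold Tame PathMove at *; omega

theorem grundy_le_add {a b c : ℕ} (h : Tame a b c) : grundy a b c ≤ a + b + c := by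
  rcases Nat.eq_zero_or_pos b with rfl | hb
  · rw [grundy_zero]
    exact xor_le_add a c
  · have := grundy_cases (a := a) (c := c) hb
    omega

theorem grundy_ne_of_exceptional {a b c b' c' : ℕ} (hb0 : 0 < b) (h : Exceptional a b c)
    (hb : b' ≤ b) (hc : c' ≤ c) (hlt : b' + c' < b + c) : grundy a b' c' ≠ grundy a b c := by
  have e₁ := grundy_eq_of_exceptional hb0 h
  unfold Exceptional at h
  rcases Nat.eq_zero_or_pos b' with rfl | hb1
  · rw [grundy_zero]
    have := xor_of_le_four (show a ≤ 4 by omega) c'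
    omega
  · have e₂ := grundy_cases (a := a) (c := c') hb1
    unfold Exceptional at e₂
    rcases h with h | h
    · omega
    · obtain ⟨rfl, h⟩ := h
      rcases e₂ with e₂ | e₂ <;> omega

theorem grundy_ne_of_exceptional_symm {a b c b' c' : ℕ} (hb0 : 0 < b) (h : Exceptional c b a)
    (hb : b' ≤ b) (hc : c' ≤ c) (hlt : b' + c' < b + c) : grundy a b' c' ≠ grundy a b c := by
  have e₁ := grundy_eq_of_exceptional hb0 h
  rw [grundy_symm] at e₁
  unfold Exceptional at h
  rcases Nat.eq_zero_or_pos b' with rfl | hb1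
  · rw [grundy_zero, Nat.xor_comm]
    have := xor_of_le_four (show c' ≤ 4 by omega) a
    omega
  · have e₂ := grundy_cases (a := a) (c := c') hb1
    unfold Exceptional at e₂
    rcases h with h | h
    · obtain ⟨rfl, h⟩ := h
      interval_cases c' <;> rcases e₂ with e₂ | e₂ <;> omega
    · obtain ⟨rfl, h⟩ := h
      interval_cases c' <;> rcases e₂ with e₂ | e₂ <;> omega

/-- A position of value `a + b + c` is not matched by a lighter one, so that only the exceptional
positions and the nim sums need an argument. -/
theorem grundy_ne_of_right {a b c b' c' : ℕ} (h : Tame a b c) (hb : b' ≤ b) (hc : c' ≤ c)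
    (hlt : b' + c' < b + c) : grundy a b' c' ≠ grundy a b c := by
  rcases Nat.eq_zero_or_pos b with rfl | hb0
  · obtain rfl : b' = 0 := by omega
    rw [grundy_zero, grundy_zero]
    intro h'
    have := Nat.xor_right_injective h'
    omega
  rcases grundy_cases (a := a) (c := c) hb0 with ⟨e | e, -⟩ | ⟨-, e⟩
  · exact grundy_ne_of_exceptional hb0 e hb hc hlt
  · exact grundy_ne_of_exceptional_symm hb0 e hb hc hlt
  · have := grundy_le_add (h.pathMove (Or.inr ⟨rfl, hb, hc, hlt⟩))
    omega

/-- No move on the path preserves the Grundy value. -/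
theorem grundy_ne {a b c a' b' c' : ℕ} (h : Tame a b c) (hm : PathMove a b c a' b' c') :
    grundy a' b' c' ≠ grundy a b c := by
  rcases hm with ⟨rfl, ha, hb, hlt⟩ | ⟨rfl, hb, hc, hlt⟩
  · rw [grundy_symm a', grundy_symm a]
    exact grundy_ne_of_right h.symm hb ha (by omega)
  · exact grundy_ne_of_right h hb hc hlt

theorem Exceptional.of_swap_le {a b c : ℕ} (hac : a ≤ c) (h : Exceptional c b a) :
    Exceptional a b c := by
  unfold Exceptional at *; omega

/-! ### Moves to every smaller Grundy value -/

/-- The case `c ≤ h` of `exists_grundy_eq`: the move keeps `c` and reaches a position whose value is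
the sum of its weights, except that `c` has to drop slightly if this position were exceptional. -/
theorem exists_grundy_eq_of_le {a b c h : ℕ} (hb : 0 < b) (ha : a ≤ 4) (hac : a ≤ c)
    (hlt : h < grundy a b c) (hch : c ≤ h) :
    ∃ a' b' c', PathMove a b c a' b' c' ∧ grundy a' b' c' = h := by
  obtain ⟨hne, hg⟩ : ¬ Exceptional a b c ∧ grundy a b c = a + b + c := by
    rcases grundy_cases (a := a) (c := c) hb with ⟨he, hg⟩ | ⟨he, hg⟩
    · have := he.elim id (Exceptional.of_swap_le hac)
      unfold Exceptional at this; omega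
    · exact ⟨fun h' => he (Or.inl h'), hg⟩
  have reach : ∀ a' b' c', PathMove a b c a' b' c' → ¬ Exceptional a' b' c' →
      ¬ Exceptional c' b' a' → 0 < b' → a' + b' + c' = h →
      ∃ a' b' c', PathMove a b c a' b' c' ∧ grundy a' b' c' = h :=
    fun a' b' c' hm h₁ h₂ h₃ h₄ => ⟨a', b', c', hm, by rw [grundy_eq_add h₁ h₂ h₃, h₄]⟩
  unfold Exceptional PathMove at *
  rcases Nat.eq_or_lt_of_le hch with rfl | hch
  · exact ⟨0, 0, c, by omega, by simp [grundy_zero]⟩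
  by_cases h₁ : h ≤ b + c
  · exact reach 0 (h - c) c (by omega) (by omega) (by omega) (by omega) (by omega)
  by_cases h₂ : h - b - c = 2 ∧ b = 1 ∧ c % 4 = 2
  · by_cases h₃ : a = 3
    · exact reach 3 1 (c - 1) (by omega) (by omega) (by omega) (by omega) (by omega)
    · exact reach 4 1 (c - 2) (by omega) (by omega) (by omega) (by omega) (by omega)
  · exact reach (h - b - c) b c (by omega) (by omega) (by omega) (by omega) (by omega)

/-- The case `h < c` of `exists_grundy_eq`: the move empties `BC` and leaves a position of two-heap
Nim if one of value `h` is within reach. Otherwise `a` is `2` or `4`, and lowering `b` alone leads to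
an exceptional position of value `h`. -/
theorem exists_grundy_eq_of_gt {a b c h : ℕ} (hb : 0 < b) (ha : a ≤ 4) (hac : a ≤ c)
    (hlt : h < grundy a b c) (hch : h < c) :
    ∃ a' b' c', PathMove a b c a' b' c' ∧ grundy a' b' c' = h := by
  by_cases h₁ : a ^^^ h ≤ c
  · refine ⟨a, 0, a ^^^ h, Or.inr ⟨rfl, by omega, h₁, ?_⟩, ?_⟩
    · omega
    · rw [grundy_zero, ← Nat.xor_assoc, Nat.xor_self, Nat.zero_xor]
  by_cases h₂ : ∃ x ≤ a, x ^^^ c = h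
  · obtain ⟨x, hx, rfl⟩ := h₂
    exact ⟨x, 0, c, Or.inl ⟨rfl, hx, by omega, by omega⟩, grundy_zero x c⟩
  have h₂' : ∀ x ≤ a, x ^^^ c ≠ h := fun x hx hxc => h₂ ⟨x, hx, hxc⟩
  have hah := xor_of_le_four ha h
  have hg := grundy_cases (a := a) (c := c) hb
  have c₁ := one_xor_cases c
  have d₁ := h₂' 1
  have c₂ := two_xor_cases c
  have d₂ := h₂' 2
  have c₃ := three_xor_cases c
  have d₃ := h₂' 3
  have c₄ := four_xor_cases c
  have d₄ := h₂' 4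
  clear h₂ h₂'
  -- From here on, nim sums are atoms for linear arithmetic.
  generalize 1 ^^^ c = x₁ at *
  generalize 2 ^^^ c = x₂ at *
  generalize 3 ^^^ c = x₃ at *
  generalize 4 ^^^ c = x₄ at *
  generalize a ^^^ h = y at *
  generalize hgr : grundy a b c = g at *
  rcases hah with hah | hah | hah | hah | hah | hah | hah
  · omega
  · omega
  · obtain ⟨rfl, hah⟩ := hah
    have hh : c = h + 1 ∧ h % 4 = 1 := by omega
    have hE : Exceptional 2 1 c := Or.inl (by omega)
    refine ⟨2, 1, c, Or.inl ⟨rfl, le_rfl, hb, ?_⟩, ?_⟩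
    · by_contra hb1
      obtain rfl : b = 1 := by omega
      rw [grundy_eq_of_exceptional hb hE] at hgr
      omega
    · rw [grundy_eq_of_exceptional one_pos hE]
      omega
  · omega
  · omega
  · obtain ⟨rfl, hah⟩ := hah
    have hh : 4 ≤ c % 8 ∧ c < h + 4 ∧ h % 8 < 4 := by omega
    have hE : Exceptional 4 (h + 4 - c) c := Or.inr (by omega)
    refine ⟨4, h + 4 - c, c, Or.inl ⟨rfl, le_rfl, ?_⟩, ?_⟩
    · unfold Exceptional at hg
      clear c₁ c₂ c₃ c₄ d₁ d₂ d₃ d₄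
      rcases hg with hg | hg <;> omega
    · rw [grundy_eq_of_exceptional (by omega) hE]
      omega
  · omega

theorem exists_grundy_eq_of_left_le {a b c h : ℕ} (hb : 0 < b) (ha : a ≤ 4) (hac : a ≤ c)
    (hlt : h < grundy a b c) : ∃ a' b' c', PathMove a b c a' b' c' ∧ grundy a' b' c' = h := by
  rcases le_or_gt c h with hch | hch
  · exact exists_grundy_eq_of_le hb ha hac hlt hch
  · exact exists_grundy_eq_of_gt hb ha hac hlt hch

/-- Every number below the Grundy value is the Grundy value after some move on the path. -/
theorem exists_grundy_eq {a b c h : ℕ} (ht : Tame a b c) (hlt : h < grundy a b c) :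
    ∃ a' b' c', PathMove a b c a' b' c' ∧ grundy a' b' c' = h := by
  rcases Nat.eq_zero_or_pos b with rfl | hb
  · rw [grundy_zero] at hlt
    rcases Nat.lt_xor_cases hlt with h' | h'
    · refine ⟨h ^^^ c, 0, c, Or.inl ⟨rfl, h'.le, le_rfl, by omega⟩, ?_⟩
      rw [grundy_zero, Nat.xor_assoc, Nat.xor_self, Nat.xor_zero]
    · refine ⟨a, 0, h ^^^ a, Or.inr ⟨rfl, le_rfl, h'.le, by omega⟩, ?_⟩
      rw [grundy_zero, Nat.xor_comm h a, ← Nat.xor_assoc, Nat.xor_self, Nat.zero_xor]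
  unfold Tame at ht
  rcases le_total a c with hac | hac
  · exact exists_grundy_eq_of_left_le hb (by omega) hac hlt
  · rw [grundy_symm] at hlt
    obtain ⟨x, y, z, hm, hg⟩ := exists_grundy_eq_of_left_le hb (by omega) hac hlt
    exact ⟨z, y, x, hm.symm, by rw [grundy_symm, hg]⟩

/-! ### Shifting the outer weights -/

/-- The nim sum with `k < 2 ^ q` stays below every multiple of `2 ^ q` that exceeds `a`. -/
theorem xor_lt_of_dvd {a k q M : ℕ} (hk : k < 2 ^ q) (hM : 2 ^ q ∣ M) (ha : a < M) :
    a ^^^ k < M := by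
  obtain ⟨u, rfl⟩ := hM
  have hq : 0 < 2 ^ q := by positivity
  rw [mul_comm] at ha ⊢
  rw [← Nat.div_lt_iff_lt_mul hq] at ha ⊢
  rwa [Nat.xor_div_two_pow, Nat.div_eq_of_lt hk, Nat.xor_zero]

/-- The positions that arise from a position `a`, `b`, `c` for which `grundy` is the Grundy function
by adding a common multiple `M` of a large power of `2` to `a` and `c`, and putting the weight
`grundy a b c` on the edge `EF`. -/
def Shifted (x b z k : ℕ) : Prop :=
  ∃ M q a c, 2 ^ q ∣ M ∧ a < 2 ^ q ∧ c < 2 ^ q ∧ k < 2 ^ q ∧ x = M + a ∧ z = M + c ∧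
    Tame a b c ∧ grundy a b c = k

theorem Shifted.symm {x b z k : ℕ} (h : Shifted x b z k) : Shifted z b x k := by
  obtain ⟨M, q, a, c, h₁, h₂, h₃, h₄, h₅, h₆, h₇, h₈⟩ := h
  exact ⟨M, q, c, a, h₁, h₃, h₂, h₄, h₆, h₅, h₇.symm, by rw [grundy_symm, h₈]⟩

theorem shifted_xor (a k : ℕ) : Shifted a 0 (a ^^^ k) k := by
  refine ⟨0, a + k, a, a ^^^ k, dvd_zero _, ?_, ?_, ?_, by simp, by simp, Or.inl rfl, ?_⟩
  · exact (Nat.le_add_right a k).trans_lt Nat.lt_two_pow_self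
  · exact (xor_le_add a k).trans_lt Nat.lt_two_pow_self
  · exact (Nat.le_add_left k a).trans_lt Nat.lt_two_pow_self
  · rw [grundy_zero, ← Nat.xor_assoc, Nat.xor_self, Nat.zero_xor]

theorem PathMove.add {a b c a' b' c' : ℕ} (M : ℕ) (h : PathMove a b c a' b' c') :
    PathMove (M + a) b (M + c) (M + a') b' (M + c') := by
  unfold PathMove at *; omega

theorem PathMove.le {a b c a' b' c' : ℕ} (h : PathMove a b c a' b' c') : a' ≤ a ∧ c' ≤ c := by
  unfold PathMove at h; omega

theorem exists_reply_of_lt {x b z k k' : ℕ} (h : Shifted x b z k) (hk : k' < k) :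
    ∃ x' b' z', PathMove x b z x' b' z' ∧ Shifted x' b' z' k' := by
  obtain ⟨M, q, a, c, h₁, h₂, h₃, h₄, rfl, rfl, h₇, rfl⟩ := h
  obtain ⟨a', b', c', hm, hg⟩ := exists_grundy_eq h₇ hk
  have := hm.le
  exact ⟨M + a', b', M + c', hm.add M, M, q, a', c', h₁, by omega, by omega, by omega, rfl, rfl,
    h₇.pathMove hm, hg⟩

/-- The answer to a move that reduces the weights of `AB` and `BC`. -/
theorem exists_reply_left {x b z k x' b' : ℕ} (h : Shifted x b z k) (hx : x' ≤ x) (hb : b' ≤ b)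
    (hlt : x' + b' < x + b) :
    ∃ x'' b'' z'' k'', QuadMove x' b' z k x'' b'' z'' k'' ∧ Shifted x'' b'' z'' k'' := by
  obtain ⟨M, q, a, c, h₁, h₂, h₃, h₄, rfl, rfl, h₇, h₈⟩ := h
  rcases lt_or_ge x' M with hM | hM
  · -- Below the common multiple, the second player empties `BC` and balances the three-heap Nim.
    have hz := xor_lt_of_dvd h₄ h₁ hM
    exact ⟨x', 0, x' ^^^ k, k, Or.inl ⟨rfl, Or.inr ⟨rfl, by omega, by omega, by omega⟩⟩,
      shifted_xor x' k⟩
  obtain ⟨a', rfl⟩ := Nat.exists_eq_add_of_le hM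
  have hm : PathMove a b c a' b' c := Or.inl ⟨rfl, by omega, hb, by omega⟩
  have ht := h₇.pathMove hm
  rcases lt_or_gt_of_ne (grundy_ne h₇ hm) with hg | hg
  · exact ⟨M + a', b', M + c, grundy a' b' c, Or.inr ⟨rfl, rfl, rfl, by omega⟩,
      M, q, a', c, h₁, by omega, h₃, by omega, rfl, rfl, ht, rfl⟩
  · obtain ⟨a'', b'', c'', hm', hg'⟩ := exists_grundy_eq ht hg
    have := hm'.le
    exact ⟨M + a'', b'', M + c'', k, Or.inl ⟨rfl, hm'.add M⟩,
      M, q, a'', c'', h₁, by omega, by omega, h₄, rfl, rfl, ht.pathMove hm', hg'.trans h₈⟩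

theorem QuadMove.symm {a b c k a' b' c' k' : ℕ} (h : QuadMove a b c k a' b' c' k') :
    QuadMove c b a k c' b' a' k' := by
  unfold QuadMove PathMove at *; omega

theorem exists_reply {x b z k x' b' z' k' : ℕ} (h : Shifted x b z k)
    (hm : QuadMove x b z k x' b' z' k') :
    ∃ x'' b'' z'' k'', QuadMove x' b' z' k' x'' b'' z'' k'' ∧ Shifted x'' b'' z'' k'' := by
  rcases hm with ⟨rfl, ⟨rfl, hx, hb, hlt⟩ | ⟨rfl, hb, hz, hlt⟩⟩ | ⟨rfl, rfl, rfl, hk⟩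
  · exact exists_reply_left h hx hb hlt
  · obtain ⟨x'', b'', z'', k'', hm, hs⟩ := exists_reply_left h.symm hz hb (by omega)
    exact ⟨z'', b'', x'', k'', hm.symm, hs.symm⟩
  · obtain ⟨x'', b'', z'', hm, hs⟩ := exists_reply_of_lt h hk
    exact ⟨x'', b'', z'', k', Or.inl ⟨rfl, hm⟩, hs⟩

theorem isLosing_of_shifted {w : Config H1}
    (h : Shifted (w edgeAB) (w edgeBC) (w edgeCD) (w edgeEF)) : IsLosing w :=
  isLosing_of_closed Shifted (fun _ _ _ _ hs _ _ _ _ hm => exists_reply hs hm) w h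

theorem isLosing_of_pair_eq {w : Config H1} {x z : ℕ}
    (hp : ({w edgeAB, w edgeCD} : Multiset ℕ) = {x, z})
    (h : Shifted x (w edgeBC) z (w edgeEF)) : IsLosing w := by
  have hxz : (w edgeAB = x ∧ w edgeCD = z) ∨ (w edgeAB = z ∧ w edgeCD = x) := by
    simp only [Multiset.insert_eq_cons, Multiset.cons_eq_cons, Multiset.singleton_inj] at hp
    rcases hp with hp | ⟨-, cs, h₁, h₂⟩
    · exact Or.inl hp
    · have h₃ := (Multiset.singleton_eq_cons_iff _).1 h₁
      have h₄ := (Multiset.singleton_eq_cons_iff _).1 h₂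
      exact Or.inr ⟨h₄.1.symm, h₃.1⟩
  rcases hxz with ⟨rfl, rfl⟩ | ⟨rfl, rfl⟩
  · exact isLosing_of_shifted h
  · exact isLosing_of_shifted h.symm

/-! ### Losing weights in terms of `k`, `r` and `s` -/

/-- The shifted positions whose Grundy value is the sum of the three weights. -/
theorem shifted_of_add {k q M r s : ℕ} (hk : k < 2 ^ q) (hM : 2 ^ q ∣ M) (hr : r ≤ 4) (hs : 0 < s)
    (hle : s + 2 * r ≤ k) (he : ¬ Exceptional r s (k - r - s)) :
    Shifted (M + r) s (M + (k - r - s)) k := by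
  refine ⟨M, q, r, k - r - s, hM, by omega, by omega, hk, rfl, rfl, Or.inr (Or.inl hr), ?_⟩
  rw [grundy_eq_add he (fun h => he (h.of_swap_le (by omega))) hs]
  omega

/-- The shifted positions whose Grundy value is exceptional. If `k < r`, then `M + r` is itself a
multiple of `2 ^ q`, so that `r` becomes part of the common multiple. -/
theorem shifted_of_exceptional {k q M r s : ℕ} (hk : k < 2 ^ q) (hq : 2 ^ q ≤ 2 * k)
    (hM : 2 ^ q ∣ M) (hs : 0 < s) (he : Exceptional r s (k + r - s)) (hsk : s ≤ k) :
    Shifted (M + r) s (M + (k + r - s)) k := by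
  have hr : (r = 2 ∧ s = 1 ∧ k % 4 = 1) ∨ (r = 4 ∧ s ≤ k % 8 ∧ k % 8 < 4) := by
    unfold Exceptional at he; omega
  rcases lt_or_ge k r with hkr | hkr
  · have hd : 2 ^ q ∣ r := by
      have hq3 : q < 3 := by
        by_contra hq3
        have := Nat.pow_le_pow_right (n := 2) (by norm_num) (not_lt.1 hq3)
        omega
      interval_cases q <;> omega
    refine ⟨M + r, q, 0, k - s, dvd_add hM hd, by omega, by omega, hk, rfl, by omega,
      Or.inr (Or.inl (by omega)), ?_⟩
    have := grundy_cases (a := 0) (c := k - s) hs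
    unfold Exceptional at this
    omega
  · have hc : r < 2 ^ q ∧ k + r - s < 2 ^ q := by
      refine ⟨by omega, ?_⟩
      rcases hr with hr | hr
      · have hd : 2 ^ 2 ∣ 2 ^ q := by
          refine pow_dvd_pow 2 ?_
          by_contra hq2
          have := Nat.pow_le_pow_right (n := 2) (by norm_num) (show q ≤ 1 by omega)
          omega
        omega
      · have hd : 2 ^ 3 ∣ 2 ^ q := by
          refine pow_dvd_pow 2 ?_
          by_contra hq2
          have := Nat.pow_le_pow_right (n := 2) (by norm_num) (show q ≤ 2 by omega)
          omega
        omega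
    refine ⟨M, q, r, k + r - s, hM, hc.1, hc.2, hk, rfl, rfl, Or.inr (Or.inl (by omega)), ?_⟩
    rw [grundy_eq_of_exceptional hs he]
    omega

end GraphNim

open GraphNim in
theorem mainTheorem2 (k m : ℕ) (hk : 1 ≤ k) (w : Config H1)
    (hpos : ∀ e, 0 < w e) (hEF : w edgeEF = k) :
    (∀ r s : ℕ, r ∈ ({0, 1, 3} : Finset ℕ) → 1 ≤ s → s + 2 * r ≤ k →
      ({w edgeAB, w edgeCD} : Multiset ℕ) =
        {2 ^ (f k + 1) * m + r, 2 ^ (f k + 1) * m + (k - r - s)} →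
      w edgeBC = s → IsLosing w) ∧
    (∀ r s j : ℕ, r ∈ ({2, 4} : Finset ℕ) → s ∈ Finset.Icc 1 (r - 1) →
      j ∈ Finset.Icc s (r - 1) → k ≡ j [MOD 2 ^ (f r + 1)] →
      ({w edgeAB, w edgeCD} : Multiset ℕ) =
        {2 ^ (f k + 1) * m + r, 2 ^ (f k + 1) * m + (k + r - s)} →
      w edgeBC = s → IsLosing w) ∧
    (∀ r s j : ℕ, r ∈ ({2, 4} : Finset ℕ) → s ∈ Finset.Icc 1 (r - 1) → 3 * r ≤ k →
      j ∈ Finset.range (2 ^ (f r + 1)) \ Finset.Icc s (r - 1) → k ≡ j [MOD 2 ^ (f r + 1)] →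
      ({w edgeAB, w edgeCD} : Multiset ℕ) =
        {2 ^ (f k + 1) * m + r, 2 ^ (f k + 1) * m + (k - r - s)} →
      w edgeBC = s → IsLosing w) ∧
    (∀ r s : ℕ, r ∈ ({2, 4} : Finset ℕ) → r ≤ s → s + 2 * r ≤ k → 3 * r ≤ k →
      ({w edgeAB, w edgeCD} : Multiset ℕ) =
        {2 ^ (f k + 1) * m + r, 2 ^ (f k + 1) * m + (k - r - s)} →
      w edgeBC = s → IsLosing w) := by
  obtain ⟨hle, hlt⟩ := (f_eq_iff (n := f k) hk).1 rfl
  have hq : 2 ^ (f k + 1) ≤ 2 * k := by rw [pow_succ]; omega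
  have hM : 2 ^ (f k + 1) ∣ 2 ^ (f k + 1) * m := dvd_mul_right _ _
  have h2 : 2 ^ (f 2 + 1) = 4 := by rw [(f_eq_iff (n := 1) (by norm_num)).2 (by norm_num)]; norm_num
  have h4 : 2 ^ (f 4 + 1) = 8 := by rw [(f_eq_iff (n := 2) (by norm_num)).2 (by norm_num)]; norm_num
  refine ⟨?_, ?_, ?_, ?_⟩
  · intro r s hr hs hsk hp hBC
    simp only [Finset.mem_insert, Finset.mem_singleton] at hr
    refine isLosing_of_pair_eq hp ?_
    rw [hBC, hEF]
    exact shifted_of_add hlt hM (by omega) hs hsk (by unfold Exceptional; omega)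
  · intro r s j hr hs hj hkj hp hBC
    simp only [Finset.mem_insert, Finset.mem_singleton, Finset.mem_Icc] at hr hs hj
    refine isLosing_of_pair_eq hp ?_
    rw [hBC, hEF]
    rcases hr with rfl | rfl
    · rw [h2, Nat.ModEq] at hkj
      exact shifted_of_exceptional hlt hq hM hs.1 (Or.inl (by omega)) (by omega)
    · rw [h4, Nat.ModEq] at hkj
      exact shifted_of_exceptional hlt hq hM hs.1 (Or.inr (by omega)) (by omega)
  · intro r s j hr hs hrk hj hkj hp hBC
    simp only [Finset.mem_insert, Finset.mem_singleton, Finset.mem_Icc, Finset.mem_sdiff,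
      Finset.mem_range] at hr hs hj
    refine isLosing_of_pair_eq hp ?_
    rw [hBC, hEF]
    rcases hr with rfl | rfl
    · rw [h2, Nat.ModEq] at hkj
      exact shifted_of_add hlt hM (by omega) hs.1 (by omega) (by unfold Exceptional; omega)
    · rw [h4, Nat.ModEq] at hkj
      exact shifted_of_add hlt hM (by omega) hs.1 (by omega) (by unfold Exceptional; omega)
  · intro r s hr hrs hsk _ hp hBC
    simp only [Finset.mem_insert, Finset.mem_singleton] at hr
    refine isLosing_of_pair_eq hp ?_
    rw [hBC, hEF]
    exact shifted_of_add hlt hM (by omega) (by omega) hsk (by unfold Exceptional; omega)
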